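/- A word is a finite (possibly empty) sequence of positive integers. Let $\equiv$ denote Knuth equivalence of words, i.e. the equivalence relation generated by $x\,acb\,y\equiv x\,cab\,y$ for $a\le b<c$ and $x\,bac\,y\equiv x\,bca\,y$ for $a<b\le c$, where $x,y$ are words and $a,b,c$ are positive integers. Let $C(1)=\{w \mid 1w\equiv w1\}$ be the centralizer of the one-letter word $1$ in the plactic monoid. Let $P(w)$ be the insertion tableau of $w$ under the Robinson–Schensted–Knuth row insertion. Let $\mathrm{lwi}(w)$ be the largest length of a weakly increasing subsequence of $w$, and let $\mathrm{lwi}(w,1)$ be the largest length of a weakly increasing subsequence of $w$ whose last entry is $1$ (equal to $0$ if $w$ contains no $1$). For every word $w$ the following are equivalent: (a) $w\in C(1)$; (b) all entries of the first row of $P(w)$ are equal to $1$ (vacuously true if $w$ is empty); (c) $\mathrm{lwi}(w)=\mathrm{lwi}(w,1)$. Furthermore, call a word Yamanouchi if each of its suffixes contains, for every $i\ge 1$, at least as many $i$'s as $(i+1)$'s. Then for every $n\ge 0$ and every word $w$ the following are equivalent: (d) $w\in C(1)\cap[2]^n$, where $[2]^n$ is the set of words of length $n$ with letters in $\{1,2\}$;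 (e) $w\in[2]^n$ and $w$ is Yamanouchi. -/

import Mathlib

/-- Words over the positive integers. -/
abbrev PWord : Type := List ℕ+

namespace PWord

/-- `KnuthStep v w`: the word `w` is obtained from `v` by one of the elementary
replacements `x a c b y ⟶ x c a b y` (`a ≤ b < c`) and `x b a c y ⟶ x b c a y` (`a < b ≤ c`). -/
inductive KnuthStep : PWord → PWord → Prop
  | acb (x y : PWord) (a b c : ℕ+) (hab : a ≤ b) (hbc : b < c) :
      KnuthStep (x ++ [a, c, b] ++ y) (x ++ [c, a, b] ++ y)
  | bac (x y : PWord) (a b c : ℕ+) (hab : a < b) (hbc : b ≤ c) :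
      KnuthStep (x ++ [b, a, c] ++ y) (x ++ [b, c, a] ++ y)

/-- Knuth equivalence: `w` is reached from `v` by finitely many replacements,
each used in either direction. -/
def KnuthEquiv (v w : PWord) : Prop := Relation.EqvGen KnuthStep v w

/-- The centralizer `C(u)` of `u` in the plactic monoid, as a set of words. -/
def centralizer (u : PWord) : Set PWord := {w | KnuthEquiv (u ++ w) (w ++ u)}

/-- Insert `x` into a row: `x` replaces (bumps) the leftmost entry greater than `x`; if there is
none, `x` is put at the end. Returns the new row and the bumped entry, if any. -/
def rowInsert (x : ℕ+) : List ℕ+ → List ℕ+ × Option ℕ+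
  | [] => ([x], none)
  | y :: r =>
    if x < y then (x :: r, some y)
    else (y :: (rowInsert x r).1, (rowInsert x r).2)

/-- Insert `x` into a tableau, given as the list of its rows from the first row on: `x` is inserted
into the first row, and a bumped entry is inserted into the tableau formed by the other rows. -/
def tableauInsert : List (List ℕ+) → ℕ+ → List (List ℕ+)
  | [], x => [[x]]
  | r :: T, x =>
    match rowInsert x r with
    | (r', none) => r' :: T
    | (r', some y) => r' :: tableauInsert T y

/-- The insertion tableau `P(w)`, as the list of its rows: the letters of `w` are inserted from
left to right, starting from the empty tableau. -/
def insertionTableau (w : PWord) : List (List ℕ+) := w.foldl tableauInsert []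

/-- The first row of a tableau; it is empty if the tableau is. -/
def firstRow (T : List (List ℕ+)) : List ℕ+ := T.headD []

/-- The largest length of a weakly increasing subsequence of `w`. -/
def lwi (w : PWord) : ℕ :=
  (w.sublists.toFinset.filter fun s => s.Pairwise (· ≤ ·)).sup List.length

/-- The largest length of a weakly increasing subsequence of `w` whose last entry is `a`;
it is `0` if there is none, that is, if `a` does not occur in `w`. -/
def lwiEnding (w : PWord) (a : ℕ+) : ℕ :=
  (w.sublists.toFinset.filter fun s => s.Pairwise (· ≤ ·) ∧ s.getLast? = some a).sup List.length

/-- Every suffix has at least as many `i`'s as `(i+1)`'s, for all `i ≥ 1`. -/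
def IsYamanouchi (w : PWord) : Prop :=
  ∀ s : PWord, s <:+ w → ∀ i : ℕ+, s.count (i + 1) ≤ s.count i

/-- The set `[m]^n` of words of length `n` with letters in `{1, …, m}`. -/
def wordsOver (m n : ℕ) : Set PWord := {w | w.length = n ∧ ∀ x ∈ w, (x : ℕ) ≤ m}

end PWord

namespace PWord

/-! ### Increasing subsequences -/

/-! All conditions reduce to `lwi w = w.count 1`; an increasing subsequence ending in 1 contains
only 1s, so `lwiEnding w 1` is the number of 1s. For (b), the first row has length `lwi w`
(`length_rowInsertWord`) and keeps every 1 of `w`, since 1 is never bumped. If `w` commutes with 1,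
Knuth invariance of `lwi` gives the equality by comparing `1w` with `w1`. Conversely, row insertion
is a chain of Knuth moves pushing each bumped letter `d` to the front of a row whose head is below
`d`; there 1 passes `d`, and at the end 1 commutes with a row of 1s
(`knuthEquiv_one_cons_of_rowInsertWord`). Over {1,2}, increasing subsequences are 1s followed by 2s,
which links the equality to the suffix counts. -/

theorem length_le_lwi {w s : PWord} (h : s.Sublist w) (hs : s.Pairwise (· ≤ ·)) :
    s.length ≤ lwi w :=
  Finset.le_sup (f := List.length) (by simp [h, hs])

theorem lwi_le {w : PWord} {n : ℕ}
    (h : ∀ s : PWord, s.Sublist w → s.Pairwise (· ≤ ·) → s.length ≤ n) : lwi w ≤ n := by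
  refine Finset.sup_le fun s hs => ?_
  simp only [Finset.mem_filter, List.mem_toFinset, List.mem_sublists] at hs
  exact h s hs.1 hs.2

theorem exists_length_eq_lwi (w : PWord) :
    ∃ s : PWord, s.Sublist w ∧ s.Pairwise (· ≤ ·) ∧ s.length = lwi w := by
  have hne : (w.sublists.toFinset.filter fun s => s.Pairwise (· ≤ ·)).Nonempty :=
    ⟨[], by simp⟩
  obtain ⟨s, hs, h⟩ := Finset.exists_mem_eq_sup _ hne List.length
  simp only [Finset.mem_filter, List.mem_toFinset, List.mem_sublists] at hs
  exact ⟨s, hs.1, hs.2, h.symm⟩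

theorem lwi_of_pairwise {w : PWord} (h : w.Pairwise (· ≤ ·)) : lwi w = w.length :=
  le_antisymm (lwi_le fun _ hs _ => hs.length_le) (length_le_lwi (List.Sublist.refl w) h)

/-- A subsequence starting with `d` cannot use `f`, so `d` can be exchanged for `f`. -/
theorem lwi_cons_cons_of_lt {d f : ℕ+} (h : f < d) (t : PWord) :
    lwi (d :: f :: t) = lwi (f :: t) := by
  apply le_antisymm
  · refine lwi_le fun s hs hp => ?_
    cases hs with
    | cons _ hs => exact length_le_lwi hs hp
    | cons_cons _ hs =>
      rename_i s
      rw [List.pairwise_cons] at hp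
      cases hs with
      | cons _ hs =>
        refine length_le_lwi (s := f :: s) (hs.cons_cons f) ?_
        exact List.pairwise_cons.2 ⟨fun x hx => h.le.trans (hp.1 x hx), hp.2⟩
      | cons_cons _ hs => exact absurd (hp.1 f (by simp)) (not_le.2 h)
  · exact lwi_le fun s hs hp => length_le_lwi (hs.cons d) hp

theorem lwi_one_cons (w : PWord) : lwi (1 :: w) = lwi w + 1 := by
  apply le_antisymm
  · refine lwi_le fun s hs hp => ?_
    cases hs with
    | cons _ hs => exact (length_le_lwi hs hp).trans (Nat.le_succ _)
    | cons_cons _ hs => simpa using length_le_lwi hs hp.of_cons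
  · obtain ⟨s, hs, hp, h⟩ := exists_length_eq_lwi w
    rw [← h]
    exact length_le_lwi (s := 1 :: s) (hs.cons_cons 1)
      (List.pairwise_cons.2 ⟨fun _ _ => one_le, hp⟩)

theorem count_one_le_lwi (w : PWord) : w.count 1 ≤ lwi w := by
  have h : (List.replicate (w.count 1) (1 : ℕ+)).Sublist w :=
    List.replicate_sublist_iff.2 le_rfl
  simpa using length_le_lwi h (List.pairwise_replicate.2 (Or.inr le_rfl))

theorem eq_replicate_one_of_getLast? {s : PWord} (hp : s.Pairwise (· ≤ ·))
    (hl : s.getLast? = some 1) : ∀ x ∈ s, (1 : ℕ+) = x := by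
  obtain ⟨t, rfl⟩ := List.getLast?_eq_some_iff.1 hl
  intro x hx
  rw [List.pairwise_append] at hp
  rcases List.mem_append.1 hx with hx | hx
  · exact le_antisymm one_le (hp.2.2 x hx 1 (by simp))
  · simpa using (List.mem_singleton.1 hx).symm

theorem lwiEnding_one (w : PWord) : lwiEnding w 1 = w.count 1 := by
  apply le_antisymm
  · refine Finset.sup_le fun s hs => ?_
    simp only [Finset.mem_filter, List.mem_toFinset, List.mem_sublists] at hs
    rw [← List.count_eq_length.2 (eq_replicate_one_of_getLast? hs.2.1 hs.2.2)]
    exact hs.1.count_le 1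
  · have h : (List.replicate (w.count 1) (1 : ℕ+)).Sublist w :=
      List.replicate_sublist_iff.2 le_rfl
    rcases Nat.eq_zero_or_pos (w.count 1) with h0 | h0
    · simp [h0]
    · have := Finset.le_sup (f := List.length)
        (s := w.sublists.toFinset.filter fun s => s.Pairwise (· ≤ ·) ∧ s.getLast? = some 1)
        (b := List.replicate (w.count 1) (1 : ℕ+)) (by
          simp only [Finset.mem_filter, List.mem_toFinset, List.mem_sublists]
          refine ⟨h, List.pairwise_replicate.2 (Or.inr le_rfl), ?_⟩
          rw [List.getLast?_replicate, if_neg h0.ne'])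
      simpa [lwiEnding] using this

theorem lwi_append_one_le (w : PWord) : lwi (w ++ [1]) ≤ max (lwi w) (w.count 1 + 1) := by
  refine lwi_le fun s hs hp => ?_
  obtain ⟨s₁, s₂, rfl, h₁, h₂⟩ := List.sublist_append_iff.1 hs
  rcases List.sublist_singleton.1 h₂ with rfl | rfl
  · rw [List.append_nil] at hp ⊢
    exact le_max_of_le_left (length_le_lwi h₁ hp)
  · refine le_max_of_le_right ?_
    rw [← List.count_eq_length.2 (eq_replicate_one_of_getLast? hp (by simp))]
    simpa using h₁.count_le 1

/-! ### Knuth equivalence -/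

/-- The bounds on `s'` let it replace `s` between the parts chosen from `x` and `y`. -/
theorem lwi_le_of_replace {x y m m' : PWord}
    (h : ∀ s : PWord, s.Sublist m → s.Pairwise (· ≤ ·) → ∃ s' : PWord, s'.Sublist m' ∧
      s'.Pairwise (· ≤ ·) ∧ s'.length = s.length ∧
      (∀ l, (∀ b ∈ s, l ≤ b) → ∀ b ∈ s', l ≤ b) ∧ (∀ u, (∀ b ∈ s, b ≤ u) → ∀ b ∈ s', b ≤ u)) :
    lwi (x ++ m ++ y) ≤ lwi (x ++ m' ++ y) := by
  refine lwi_le fun s hs hp => ?_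
  obtain ⟨s₁₂, s₃, rfl, h₁₂, h₃⟩ := List.sublist_append_iff.1 hs
  obtain ⟨s₁, s₂, rfl, h₁, h₂⟩ := List.sublist_append_iff.1 h₁₂
  simp only [List.pairwise_append, List.mem_append] at hp
  obtain ⟨⟨p₁, p₂, p₁₂⟩, p₃, p₁₃⟩ := hp
  obtain ⟨s', hs', hp', hl, hlo, hup⟩ := h s₂ h₂ p₂
  have key := length_le_lwi (s := s₁ ++ s' ++ s₃) ((h₁.append hs').append h₃) (by
    simp only [List.pairwise_append, List.mem_append]
    refine ⟨⟨p₁, hp', fun a ha => hlo a (p₁₂ a ha)⟩, p₃, ?_⟩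
    rintro a (ha | ha) b hb
    · exact p₁₃ a (Or.inl ha) b hb
    · exact hup b (fun c hc => p₁₃ c (Or.inr hc) b hb) a ha)
  simpa [hl] using key

theorem sublist_triple_cases {s : PWord} {p q r : ℕ+} (h : s.Sublist [p, q, r]) :
    s = [] ∨ s = [r] ∨ s = [q] ∨ s = [q, r] ∨ s = [p] ∨ s = [p, r] ∨ s = [p, q] ∨
      s = [p, q, r] := by
  simpa [List.sublists'_cons] using List.mem_sublists'.2 h

theorem KnuthStep.lwi_eq {v w : PWord} (h : KnuthStep v w) : lwi v = lwi w := by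
  cases h with
  | acb x y a b c hab hbc =>
    have hac := hab.trans_lt hbc
    apply le_antisymm <;> refine lwi_le_of_replace fun s hs hp => ?_
    · rcases sublist_triple_cases hs with rfl | rfl | rfl | rfl | rfl | rfl | rfl | rfl
      -- `ac` is the only increasing subsequence of `acb` lost in `cab`; `ab` replaces it.
      case inr.inr.inr.inr.inr.inr.inl =>
        refine ⟨[a, b], by simp, by simpa using hab, rfl, fun l hl => ?_, fun u hu => ?_⟩
        · have := hl a (by simp)
          simpa using ⟨this, this.trans hab⟩
        · have := hu c (by simp)
          simpa using ⟨hu a (by simp), hbc.le.trans this⟩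
      all_goals first
        | (simp [hbc.not_ge] at hp; done)
        | exact ⟨_, by simp, hp, rfl, fun _ h => h, fun _ h => h⟩
    · rcases sublist_triple_cases hs with rfl | rfl | rfl | rfl | rfl | rfl | rfl | rfl
      all_goals first
        | (simp [hbc.not_ge, hac.not_ge] at hp; done)
        | exact ⟨_, by simp, hp, rfl, fun _ h => h, fun _ h => h⟩
  | bac x y a b c hab hbc =>
    have hac := hab.trans_le hbc
    apply le_antisymm <;> refine lwi_le_of_replace fun s hs hp => ?_
    · rcases sublist_triple_cases hs with rfl | rfl | rfl | rfl | rfl | rfl | rfl | rfl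
      -- Here `ac` is lost in `bca`, and `bc` replaces it.
      case inr.inr.inr.inl =>
        refine ⟨[b, c], by simp, by simpa using hbc, rfl, fun l hl => ?_, fun u hu => ?_⟩
        · have := hl a (by simp)
          simpa using ⟨this.trans hab.le, hl c (by simp)⟩
        · have := hu c (by simp)
          simpa using ⟨hbc.trans this, this⟩
      all_goals first
        | (simp [hab.not_ge] at hp; done)
        | exact ⟨_, by simp, hp, rfl, fun _ h => h, fun _ h => h⟩
    · rcases sublist_triple_cases hs with rfl | rfl | rfl | rfl | rfl | rfl | rfl | rfl
      all_goals first
        | (simp [hab.not_ge, hac.not_ge] at hp; done)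
        | exact ⟨_, by simp, hp, rfl, fun _ h => h, fun _ h => h⟩

theorem KnuthEquiv.lwi_eq {v w : PWord} (h : KnuthEquiv v w) : lwi v = lwi w := by
  induction h with
  | rel _ _ h => exact h.lwi_eq
  | refl _ => rfl
  | symm _ _ _ ih => exact ih.symm
  | trans _ _ _ _ _ ih₁ ih₂ => exact ih₁.trans ih₂

theorem KnuthEquiv.refl (v : PWord) : KnuthEquiv v v := Relation.EqvGen.refl v

theorem KnuthEquiv.symm {v w : PWord} (h : KnuthEquiv v w) : KnuthEquiv w v :=
  Relation.EqvGen.symm _ _ h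

theorem KnuthEquiv.trans {u v w : PWord} (h : KnuthEquiv u v) (h' : KnuthEquiv v w) :
    KnuthEquiv u w :=
  Relation.EqvGen.trans _ _ _ h h'

theorem KnuthStep.append {v w : PWord} (p q : PWord) (h : KnuthStep v w) :
    KnuthStep (p ++ v ++ q) (p ++ w ++ q) := by
  cases h with
  | acb x y a b c hab hbc => simpa using KnuthStep.acb (p ++ x) (y ++ q) a b c hab hbc
  | bac x y a b c hab hbc => simpa using KnuthStep.bac (p ++ x) (y ++ q) a b c hab hbc

theorem KnuthEquiv.append {v w : PWord} (p q : PWord) (h : KnuthEquiv v w) :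
    KnuthEquiv (p ++ v ++ q) (p ++ w ++ q) := by
  induction h with
  | rel _ _ h => exact Relation.EqvGen.rel _ _ (h.append p q)
  | refl _ => exact .refl _
  | symm _ _ _ ih => exact ih.symm
  | trans _ _ _ _ _ ih₁ ih₂ => exact ih₁.trans ih₂

theorem KnuthEquiv.cons {v w : PWord} (a : ℕ+) (h : KnuthEquiv v w) :
    KnuthEquiv (a :: v) (a :: w) := by
  simpa using h.append [a] []

theorem KnuthEquiv.append_right {v w : PWord} (q : PWord) (h : KnuthEquiv v w) :
    KnuthEquiv (v ++ q) (w ++ q) := by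
  simpa using h.append [] q

theorem knuthEquiv_cons_cons_swap {a b c : ℕ+} (hab : a ≤ b) (hbc : b < c) (t : PWord) :
    KnuthEquiv (a :: c :: b :: t) (c :: a :: b :: t) :=
  .rel _ _ (by simpa using KnuthStep.acb [] t a b c hab hbc)

/-- `x` moves left through `r`: it passes each letter `z` because the letter before `z` lies
strictly above `x` and weakly below `z`. -/
theorem knuthEquiv_append_singleton_of_lt {x y : ℕ+} (hxy : x < y) (r : PWord) :
    (y :: r).Pairwise (· ≤ ·) → KnuthEquiv (y :: r ++ [x]) (y :: x :: r) := by
  induction r generalizing y with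
  | nil => exact fun _ => .refl _
  | cons z r ih =>
    intro h
    have hyz : y ≤ z := (List.pairwise_cons.1 h).1 z (by simp)
    refine ((ih (hxy.trans_le hyz) h.of_cons).cons y).trans (KnuthEquiv.symm ?_)
    exact .rel _ _ (by simpa using KnuthStep.bac [] r x y z hxy hyz)

/-! ### Row insertion -/

theorem mem_rowInsert {x z : ℕ+} {r : List ℕ+} (h : z ∈ (rowInsert x r).1) : z = x ∨ z ∈ r := by
  induction r with
  | nil => simpa [rowInsert] using h
  | cons y r ih =>
    unfold rowInsert at h
    split_ifs at h
    · rcases List.mem_cons.1 h with h | h <;> simp [h]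
    · rcases List.mem_cons.1 h with h | h
      · simp [h]
      · rcases ih h with h | h <;> simp [h]

theorem pairwise_rowInsert (x : ℕ+) {r : List ℕ+} (h : r.Pairwise (· ≤ ·)) :
    (rowInsert x r).1.Pairwise (· ≤ ·) := by
  induction r with
  | nil => simp [rowInsert]
  | cons y r ih =>
    rw [List.pairwise_cons] at h
    unfold rowInsert
    split_ifs with hxy
    · exact List.pairwise_cons.2 ⟨fun z hz => hxy.le.trans (h.1 z hz), h.2⟩
    · refine List.pairwise_cons.2 ⟨fun z hz => ?_, ih h.2⟩
      rcases mem_rowInsert hz with rfl | hz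
      · exact not_lt.1 hxy
      · exact h.1 z hz

theorem rowInsert_of_none {x : ℕ+} {r : List ℕ+} (h : (rowInsert x r).2 = none) :
    (rowInsert x r).1 = r ++ [x] := by
  induction r with
  | nil => rfl
  | cons y r ih =>
    unfold rowInsert at h ⊢
    split_ifs at h ⊢
    simpa using ih h

/-- The strict inequality `f < d` is what lets `d` be discarded in computing `lwi`, and lets smaller
letters pass `d`. -/
theorem exists_rowInsert_eq_cons {x d : ℕ+} {r : List ℕ+} (hr : r.Pairwise (· ≤ ·))
    (h : (rowInsert x r).2 = some d) : x < d ∧ ∃ f t, (rowInsert x r).1 = f :: t ∧ f < d := by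
  induction r with
  | nil => simp [rowInsert] at h
  | cons y r ih =>
    unfold rowInsert at h ⊢
    split_ifs at h ⊢ with hxy
    · obtain rfl : y = d := by simpa using h
      exact ⟨hxy, x, r, rfl, hxy⟩
    · have hxd := (ih hr.of_cons h).1
      exact ⟨hxd, y, _, rfl, (not_lt.1 hxy).trans_lt hxd⟩

theorem knuthEquiv_of_rowInsert_eq_some {x d : ℕ+} {r : List ℕ+} (hr : r.Pairwise (· ≤ ·))
    (h : (rowInsert x r).2 = some d) : KnuthEquiv (r ++ [x]) (d :: (rowInsert x r).1) := by
  induction r with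
  | nil => simp [rowInsert] at h
  | cons y r ih =>
    have hp := pairwise_rowInsert x hr
    unfold rowInsert at h hp ⊢
    split_ifs at h hp ⊢ with hxy
    · obtain rfl : y = d := by simpa using h
      exact knuthEquiv_append_singleton_of_lt hxy r hr
    -- The bumped letter `d` now moves left past `y`, using `y ≤ f < d` for the next letter `f`.
    · refine ((ih hr.of_cons h).cons y).trans ?_
      obtain ⟨-, f, t, hft, hfd⟩ := exists_rowInsert_eq_cons hr.of_cons h
      simp only [hft] at hp ⊢
      exact knuthEquiv_cons_cons_swap ((List.pairwise_cons.1 hp).1 f (by simp)) hfd t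

theorem count_one_rowInsert (x : ℕ+) (r : List ℕ+) :
    (rowInsert x r).1.count 1 = (x :: r).count 1 := by
  induction r with
  | nil => rfl
  | cons y r ih =>
    unfold rowInsert
    split_ifs with hxy
    · have : y ≠ 1 := (one_le.trans_lt hxy).ne'
      simp [List.count_cons, this]
    · simp only [List.count_cons] at ih ⊢
      omega

/-- The row obtained from `r` by inserting the letters of `w` one after the other. -/
def rowInsertWord (r : List ℕ+) (w : PWord) : List ℕ+ :=
  w.foldl (fun r x => (rowInsert x r).1) r

theorem firstRow_tableauInsert (T : List (List ℕ+)) (x : ℕ+) :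
    firstRow (tableauInsert T x) = (rowInsert x (firstRow T)).1 := by
  cases T with
  | nil => rfl
  | cons r T =>
    unfold tableauInsert
    split <;> rename_i h <;> simp [firstRow, h]

theorem firstRow_foldl_tableauInsert (T : List (List ℕ+)) (w : PWord) :
    firstRow (w.foldl tableauInsert T) = rowInsertWord (firstRow T) w := by
  induction w generalizing T with
  | nil => rfl
  | cons x w ih => simpa [rowInsertWord, firstRow_tableauInsert] using ih (tableauInsert T x)

theorem firstRow_insertionTableau (w : PWord) :
    firstRow (insertionTableau w) = rowInsertWord [] w :=
  firstRow_foldl_tableauInsert [] w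

theorem count_one_rowInsertWord (r : List ℕ+) (w : PWord) :
    (rowInsertWord r w).count 1 = r.count 1 + w.count 1 := by
  induction w generalizing r with
  | nil => simp [rowInsertWord]
  | cons x w ih =>
    have := ih (rowInsert x r).1
    rw [count_one_rowInsert] at this
    simp only [List.count_cons] at this ⊢
    exact this.trans (by omega)

/-- Schensted's theorem, with an arbitrary row to start from. -/
theorem length_rowInsertWord {r : List ℕ+} (hr : r.Pairwise (· ≤ ·)) (w : PWord) :
    (rowInsertWord r w).length = lwi (r ++ w) := by
  induction w generalizing r with
  | nil => simp [rowInsertWord, lwi_of_pairwise hr]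
  | cons x w ih =>
    refine (ih (pairwise_rowInsert x hr)).trans ?_
    rw [List.append_cons]
    cases h : (rowInsert x r).2 with
    | none => rw [rowInsert_of_none h]
    | some d =>
      rw [((knuthEquiv_of_rowInsert_eq_some hr h).append_right w).lwi_eq]
      obtain ⟨-, f, t, hft, hfd⟩ := exists_rowInsert_eq_cons hr h
      rw [hft]
      exact (lwi_cons_cons_of_lt hfd (t ++ w)).symm

/-- Allowing any starting row makes the induction run: after a bump, `r ++ [x]` becomes `d` followed
by the new row, and 1 is swapped with `d` in front of that row. -/
theorem knuthEquiv_one_cons_of_rowInsertWord {r : List ℕ+} (hr : r.Pairwise (· ≤ ·)) (w : PWord)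
    (h : ∀ x ∈ rowInsertWord r w, x = 1) : KnuthEquiv (1 :: (r ++ w)) (r ++ w ++ [1]) := by
  induction w generalizing r with
  | nil =>
    obtain ⟨n, rfl⟩ : ∃ n, r = List.replicate n 1 := ⟨_, List.eq_replicate_of_mem h⟩
    rw [List.append_nil, ← List.replicate_succ, List.replicate_succ']
    exact .refl _
  | cons x w ih =>
    have key := ih (pairwise_rowInsert x hr) h
    rw [List.append_cons]
    cases hd : (rowInsert x r).2 with
    | none => rwa [rowInsert_of_none hd] at key
    | some d =>
      have hk := (knuthEquiv_of_rowInsert_eq_some hr hd).append_right w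
      refine (hk.cons 1).trans (KnuthEquiv.trans ?_ (hk.append_right [1]).symm)
      refine KnuthEquiv.trans ?_ (key.cons d)
      obtain ⟨-, f, t, hft, hfd⟩ := exists_rowInsert_eq_cons hr hd
      rw [hft]
      exact knuthEquiv_cons_cons_swap one_le hfd (t ++ w)

/-! ### The centralizer of the letter `1` -/

theorem lwi_eq_count_one_of_mem_centralizer {w : PWord} (h : w ∈ centralizer [1]) :
    lwi w = w.count 1 := by
  have h₁ : lwi (1 :: w) = lwi (w ++ [1]) := KnuthEquiv.lwi_eq h
  have h₂ := lwi_one_cons w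
  have h₃ := lwi_append_one_le w
  have h₄ := count_one_le_lwi w
  -- `lwi w + 1 ≤ max (lwi w) (w.count 1 + 1)` forces `lwi w ≤ w.count 1`.
  omega

theorem firstRow_eq_one_iff (w : PWord) :
    (∀ x ∈ firstRow (insertionTableau w), x = 1) ↔ lwi w = w.count 1 := by
  have h₁ := length_rowInsertWord List.Pairwise.nil w
  have h₂ := count_one_rowInsertWord [] w
  rw [List.nil_append] at h₁
  rw [List.count_nil, zero_add] at h₂
  rw [firstRow_insertionTableau, ← h₁, ← h₂, eq_comm (a := List.length _), List.count_eq_length]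
  simp only [eq_comm]

theorem mem_centralizer_one_iff (w : PWord) : w ∈ centralizer [1] ↔ lwi w = w.count 1 := by
  refine ⟨lwi_eq_count_one_of_mem_centralizer, fun h => ?_⟩
  rw [← firstRow_eq_one_iff, firstRow_insertionTableau] at h
  exact knuthEquiv_one_cons_of_rowInsertWord List.Pairwise.nil w h

/-! ### Yamanouchi words in two letters -/

theorem IsYamanouchi.length_le_count_one {w : PWord} (h2 : ∀ x ∈ w, (x : ℕ) ≤ 2)
    (h : IsYamanouchi w) {s : PWord} (hs : s.Sublist w) (hp : s.Pairwise (· ≤ ·)) :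
    s.length ≤ w.count 1 := by
  induction w generalizing s with
  | nil => simp [List.sublist_nil.1 hs]
  | cons a w ih =>
    have ih := fun {s} => @ih (fun x hx => h2 x (by simp [hx]))
      (fun t ht => h t (ht.trans (List.suffix_cons a w))) s
    cases hs with
    | cons _ hs => exact (ih hs hp).trans (List.count_le_count_cons)
    | cons_cons _ hs =>
      rename_i s
      by_cases ha : a = 1
      · subst ha
        simpa using ih hs hp.of_cons
      -- A subsequence starting with 2 has only 2s, so the Yamanouchi condition for the whole word
      -- bounds it.
      · have hs2 : ∀ x ∈ a :: s, (2 : ℕ+) = x := by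
          intro x hx
          have hax : a ≤ x := by
            rcases List.mem_cons.1 hx with rfl | hx
            · exact le_rfl
            · exact (List.pairwise_cons.1 hp).1 x hx
          have h1 : (a : ℕ) ≠ 1 := fun h => ha (PNat.coe_eq_one_iff.1 h)
          have h3 : (x : ℕ) ≤ 2 := h2 x ((hs.cons_cons a).subset hx)
          have h4 : (a : ℕ) ≤ x := hax
          have h5 := a.pos
          apply PNat.eq
          change 2 = (x : ℕ)
          omega
        rw [← List.count_eq_length.2 hs2]
        exact ((hs.cons_cons a).count_le 2).trans (h _ List.suffix_rfl 1)

theorem isYamanouchi_of_lwi_eq {w : PWord} (h2 : ∀ x ∈ w, (x : ℕ) ≤ 2)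
    (h : lwi w = w.count 1) : IsYamanouchi w := by
  rintro s ⟨p, rfl⟩ i
  by_cases hi : i = 1
  · subst hi
    have hp : (List.replicate (p.count 1) (1 : ℕ+)).Sublist p :=
      List.replicate_sublist_iff.2 le_rfl
    have hs : (List.replicate (s.count (1 + 1)) (1 + 1 : ℕ+)).Sublist s :=
      List.replicate_sublist_iff.2 le_rfl
    -- The 1s of `p` followed by the 2s of `s` are increasing, so they number at most the 1s of `p
    -- ++ s`; cancel those of `p`.
    have key := length_le_lwi (hp.append hs) (by
      rw [List.pairwise_append]
      refine ⟨List.pairwise_replicate.2 (Or.inr le_rfl),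
        List.pairwise_replicate.2 (Or.inr le_rfl), fun a ha b _ => ?_⟩
      rw [List.eq_of_mem_replicate ha]
      exact one_le)
    simp only [List.length_append, List.length_replicate, h, List.count_append] at key
    omega
  · have : i + 1 ∉ s := fun hs => by
      have h3 := h2 _ (List.mem_append_right p hs)
      have h1 : (i : ℕ) ≠ 1 := fun h => hi (PNat.coe_eq_one_iff.1 h)
      have h5 := i.pos
      rw [PNat.add_coe, PNat.one_coe] at h3
      omega
    simp [List.count_eq_zero.2 this]

end PWord

theorem corollaryC :
    (∀ w : PWord, List.TFAE
      [w ∈ PWord.centralizer [1],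
       ∀ x ∈ PWord.firstRow (PWord.insertionTableau w), x = 1,
       PWord.lwi w = PWord.lwiEnding w 1]) ∧
    (∀ (n : ℕ) (w : PWord),
      w ∈ PWord.centralizer [1] ∩ PWord.wordsOver 2 n ↔
        w ∈ PWord.wordsOver 2 n ∧ PWord.IsYamanouchi w) := by
  refine ⟨fun w => ?_, fun n w => ?_⟩
  · rw [PWord.lwiEnding_one]
    tfae_have 1 ↔ 3 := PWord.mem_centralizer_one_iff w
    tfae_have 2 ↔ 3 := PWord.firstRow_eq_one_iff w
    tfae_finish
  · rw [Set.mem_inter_iff, and_comm, PWord.mem_centralizer_one_iff]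
    refine and_congr_right fun hw => ⟨PWord.isYamanouchi_of_lwi_eq hw.2, fun h => ?_⟩
    exact le_antisymm (PWord.lwi_le fun s hs hp => h.length_le_count_one hw.2 hs hp)
      (PWord.count_one_le_lwi w)
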